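/- Let $(R,\mathfrak m,k)$ be a commutative Noetherian local ring with $\mathfrak m^4=0$, and let $H_R(t)=\sum_{i\ge 0}\dim_k(\mathfrak m^i/\mathfrak m^{i+1})\,t^i$ be the Hilbert series of its associated graded ring; put $e=\dim_k(\mathfrak m/\mathfrak m^2)$ and $f=\dim_k(\mathfrak m^2/\mathfrak m^3)$. Let $M$ be a finitely generated $R$-module with minimal free resolution $F=(F_i,\partial_i)$ and Betti numbers $b_i=\operatorname{rank}F_i$. For $j\in\mathbb Z$ let $\operatorname{gr}(F)^j$ be the complex with $i$-th term $\mathfrak m^{j-i}F_i/\mathfrak m^{j-i+1}F_i$ (where $\mathfrak m^n=R$ for $n\le 0$) and differentials induced by $\partial$, and let $\operatorname{gr}(F)=\bigoplus_j \operatorname{gr}(F)^j$. Assume that $F$ is eventually linear, i.e. that there is $n\in\mathbb N$ with $H_i(\operatorname{gr}(F))=0$ for all $i\ge n$ (finite linearity defect). 1. Suppose that $(b_i)$ has polynomial growth: there are $n\in\mathbb N$, a real $\alpha>0$ and a real sequence $(\lambda_i)$ with $\lambda_i/i^n\to 0$ such that $\alpha i^n-\lambda_i\le b_i\le \alpha i^n+\lambda_i$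 for all $i\gg 0$. Then $$H_R(t)=1+et+ft^2+(f-e+1)t^3.$$ 2. Suppose that $(b_i)$ has exponential growth of base $a$, where $a>1$ is real: there are a real $\beta>0$ and a real sequence $(\rho_i)$ with $\rho_i/a^i\to 0$ such that $\beta a^i-\rho_i\le b_i\le \beta a^i+\rho_i$ for all $i\gg 0$. Then $$H_R(t)=1+et+ft^2+(af-a^2e+a^3)t^3.$$ -/

import Mathlib

open CategoryTheory IsLocalRing Filter Topology

universe u v

noncomputable section

namespace LinRes

section Complexes

variable {R : Type u} [CommRing R] [IsLocalRing R]

/-- The submodule `𝔪 ^ n N` of `N`, for an integer `n`, with the convention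
`𝔪 ^ n = R` for `n ≤ 0`. -/
def powSMul (R : Type u) [CommRing R] [IsLocalRing R] (n : ℤ)
    (N : Type v) [AddCommGroup N] [Module R N] : Submodule R N :=
  maximalIdeal R ^ n.toNat • (⊤ : Submodule R N)

/-- A complex over a local ring is minimal if every differential has its image in `𝔪` times
its target. -/
def IsMinimalComplex (C : ChainComplex (ModuleCat.{v} R) ℕ) : Prop :=
  ∀ i i' : ℕ, LinearMap.range (C.d i i').hom ≤ maximalIdeal R • ⊤

theorem powSMul_map_le {N N' : Type v} [AddCommGroup N] [Module R N] [AddCommGroup N']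
    [Module R N'] (φ : N →ₗ[R] N') (hφ : LinearMap.range φ ≤ maximalIdeal R • ⊤) (n : ℤ) :
    powSMul R n N ≤ (powSMul R (n + 1) N').comap φ := by
  rw [← Submodule.map_le_iff_le_comap, powSMul, powSMul, Submodule.map_smul'', Submodule.map_top]
  refine (Submodule.smul_mono le_rfl hφ).trans ?_
  rw [← Submodule.mul_smul, ← pow_succ]
  exact Submodule.smul_mono_left (Ideal.pow_le_pow_right (by omega))

theorem powSMul_d_le {C : ChainComplex (ModuleCat.{v} R) ℕ} (hC : IsMinimalComplex C)
    (j : ℤ) (i i' : ℕ) :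
    powSMul R (j - i) (C.X i) ≤ (powSMul R (j - i') (C.X i')).comap (C.d i i').hom := by
  by_cases h : i' + 1 = i
  · have := powSMul_map_le (C.d i i').hom (hC i i') (j - i)
    have e : j - (i : ℤ) + 1 = j - i' := by omega
    rwa [e] at this
  · have h0 : C.d i i' = 0 := C.shape i i' h
    intro x _
    simp [h0]

/-- The degree `j` strand of the associated graded complex of a minimal complex `C`: its term in
homological degree `i` is `𝔪 ^ (j - i) C_i / 𝔪 ^ (j - i + 1) C_i`, and its differentials are
induced by those of `C`. -/
def grStrand (C : ChainComplex (ModuleCat.{v} R) ℕ) (hC : IsMinimalComplex C) (j : ℤ) :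
    ChainComplex (ModuleCat.{v} R) ℕ where
  X i := ModuleCat.of R
    (powSMul R (j - i) (C.X i) ⧸
      (powSMul R (j + 1 - i) (C.X i)).submoduleOf (powSMul R (j - i) (C.X i)))
  d i i' := ModuleCat.ofHom <|
    Submodule.mapQ _ _ ((C.d i i').hom.restrict (powSMul_d_le hC j i i'))
      (fun x hx => powSMul_d_le hC (j + 1) i i' hx)
  shape i i' h := by
    have h0 : C.d i i' = 0 := C.shape i i' h
    ext x
    refine (Submodule.Quotient.mk_eq_zero _).2 ?_
    simp [Submodule.submoduleOf, h0]
  d_comp_d' i i' i'' _ _ := by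
    ext x
    refine (Submodule.Quotient.mk_eq_zero _).2 ?_
    have h0 : (C.d i' i'').hom ((C.d i i').hom x.1) = 0 := by
      rw [← LinearMap.comp_apply, ← ModuleCat.hom_comp, C.d_comp_d]
      rfl
    simp [Submodule.submoduleOf, h0]

end Complexes

/-- A minimal free resolution of a module over a local ring: a resolution by finitely generated
free modules whose underlying complex is minimal. -/
structure MinimalFreeResolution (R : Type u) [CommRing R] [IsLocalRing R]
    (M : Type v) [AddCommGroup M] [Module R M] where
  /-- the underlying resolution -/
  toRes : ProjectiveResolution (ModuleCat.of R M)
  free : ∀ i, Module.Free R (toRes.complex.X i)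
  finite : ∀ i, Module.Finite R (toRes.complex.X i)
  minimal : IsMinimalComplex toRes.complex

namespace MinimalFreeResolution

variable {R : Type u} [CommRing R] [IsLocalRing R] {M : Type v} [AddCommGroup M] [Module R M]

/-- The Betti sequence: the ranks of the free modules in a minimal free resolution. -/
def betti (F : MinimalFreeResolution R M) (i : ℕ) : ℕ :=
  Module.finrank R (F.toRes.complex.X i)

/-- The `i`-th homology of the associated graded complex (the direct sum of its strands)
vanishes. -/
def GrHomologyVanishes (F : MinimalFreeResolution R M) (i : ℕ) : Prop :=
  ∀ j : ℤ, (grStrand F.toRes.complex F.minimal j).ExactAt i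

/-- The linearity defect: the least `n` such that the homology of the associated graded complex
vanishes in all degrees `i ≥ n`, and `⊤` if there is no such `n`. -/
def linearityDefect (F : MinimalFreeResolution R M) : ℕ∞ :=
  ⨅ (n : ℕ) (_ : ∀ i ≥ n, F.GrHomologyVanishes i), (n : ℕ∞)

/-- The resolution is eventually linear: its linearity defect is finite. -/
def IsEventuallyLinear (F : MinimalFreeResolution R M) : Prop :=
  F.linearityDefect < ⊤

end MinimalFreeResolution

/-- `dim_k (𝔪 ^ i / 𝔪 ^ (i + 1))`, where the quotient is written `𝔪 ^ i / 𝔪 𝔪 ^ i`, which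
carries Mathlib's structure of a vector space over `k = R / 𝔪`. -/
def hilbertFunction (R : Type u) [CommRing R] [IsLocalRing R] (i : ℕ) : ℕ :=
  Module.finrank (R ⧸ maximalIdeal R)
    (↥(maximalIdeal R ^ i) ⧸ (maximalIdeal R • ⊤ : Submodule R ↥(maximalIdeal R ^ i)))

/-- The Hilbert series of the associated graded ring of `R`. -/
def hilbertSeries (R : Type u) [CommRing R] [IsLocalRing R] : PowerSeries ℤ :=
  PowerSeries.mk fun i => (hilbertFunction R i : ℤ)

/-- Polynomial growth: `α i ^ n - l i ≤ b i ≤ α i ^ n + l i` for large `i`, with `l i / i ^ n`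
tending to `0`. -/
def HasPolynomialGrowth (b : ℕ → ℕ) : Prop :=
  ∃ (n : ℕ) (α : ℝ) (l : ℕ → ℝ), 0 < α ∧
    Tendsto (fun i : ℕ => l i / (i : ℝ) ^ n) atTop (𝓝 0) ∧
    ∀ᶠ i : ℕ in atTop,
      α * (i : ℝ) ^ n - l i ≤ (b i : ℝ) ∧ (b i : ℝ) ≤ α * (i : ℝ) ^ n + l i

/-- Exponential growth of base `a > 1`: `β a ^ i - r i ≤ b i ≤ β a ^ i + r i` for large `i`, with
`r i / a ^ i` tending to `0`. -/
def HasExponentialGrowth (a : ℝ) (b : ℕ → ℕ) : Prop :=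
  1 < a ∧ ∃ (β : ℝ) (r : ℕ → ℝ), 0 < β ∧
    Tendsto (fun i : ℕ => r i / a ^ i) atTop (𝓝 0) ∧
    ∀ᶠ i : ℕ in atTop, β * a ^ i - r i ≤ (b i : ℝ) ∧ (b i : ℝ) ≤ β * a ^ i + r i

end LinRes

end

/-!
Let `h i = hilbertFunction R i` and `b i = F.betti i`.  The term of the strand `gr(F)^j` in
homological degree `j - s` has length `h s * b (j - s)` (`length_grStrand_X`), because `𝔪 ^ s F_i`
is isomorphic to a direct sum of `b i` copies of `𝔪 ^ s`.  As `𝔪 ^ 4 = 0`, the strand has at most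
four nonzero terms, those with `0 ≤ s ≤ 3`.  If the homology of the associated graded complex
vanishes from degree `n` on and `j ≥ n + 4`, then the strand is an exact sequence

  `0 → F_j / 𝔪 F_j → 𝔪 F_{j-1} / 𝔪² F_{j-1} → 𝔪² F_{j-2} / 𝔪³ F_{j-2} → 𝔪³ F_{j-3} → 0`,

and counting lengths gives the linear recurrence
`b j + h 2 * b (j - 2) = h 1 * b (j - 1) + h 3 * b (j - 3)` for large `j` (`eventually_betti_rec`).
If `b i / w i` has a nonzero limit for a weight `w` with `w (i + 1) / w i → r`, then `r` is a root
of the characteristic polynomial of the recurrence, so `h 3 = r * h 2 - r ^ 2 * h 1 + r ^ 3`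
(`characteristic_eq_of_ratio_tendsto`).  Polynomial growth is the case `w i = i ^ n`, `r = 1`, and
exponential growth the case `w i = a ^ i`, `r = a`.
-/



namespace LinRes

/-! ### Lengths of modules over a ring -/

section Length

variable {R : Type u} [CommRing R]

theorem mem_ideal_smul_top_iff_coord {N ι : Type*} [AddCommGroup N] [Module R N] [Fintype ι]
    (B : Module.Basis ι R N) (I : Ideal R) (x : N) :
    x ∈ (I • ⊤ : Submodule R N) ↔ ∀ i, B.coord i x ∈ I := by
  constructor
  · intro hx i
    induction hx using Submodule.smul_induction_on' with
    | smul r hr y _ => simpa using I.mul_mem_right _ hr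
    | add y _ z _ hy hz => simpa using I.add_mem hy hz
  · intro h
    rw [← B.sum_repr x]
    exact Submodule.sum_mem _ fun i _ => Submodule.smul_mem_smul (h i) trivial

theorem length_ideal_smul_top [Nontrivial R] (N : Type v) [AddCommGroup N] [Module R N]
    [Module.Free R N] [Module.Finite R N] (I : Ideal R) :
    Module.length R (I • ⊤ : Submodule R N) = Module.finrank R N * Module.length R I := by
  let B := Module.finBasis R N
  let φ : (I • ⊤ : Submodule R N) →ₗ[R] (Fin (Module.finrank R N) → I) :=
    LinearMap.pi fun i => ((B.coord i).comp (Submodule.subtype _)).codRestrict I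
      fun x => (mem_ideal_smul_top_iff_coord B I x.1).1 x.2 i
  have hφ : Function.Bijective φ := by
    constructor
    · intro x y h
      refine Subtype.ext (B.ext_elem fun i => ?_)
      exact congrArg Subtype.val (congrFun h i)
    · intro g
      have hg : ∀ i, B.coord i (∑ k, (g k : R) • B k) = g i := fun i => by
        rw [Module.Basis.coord_apply, B.repr_sum_self]
      refine ⟨⟨∑ k, (g k : R) • B k,
        (mem_ideal_smul_top_iff_coord B I _).2 fun i => ?_⟩, ?_⟩
      · rw [hg]
        exact (g i).2
      · funext i
        exact Subtype.ext (hg i)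
  rw [(LinearEquiv.ofBijective φ hφ).length_eq, Module.length_pi]
  simp

theorem length_eq_length_submodule_add_length_quotient {N : Type*} [AddCommGroup N] [Module R N]
    (P : Submodule R N) :
    Module.length R N = Module.length R P + Module.length R (N ⧸ P) :=
  Module.length_eq_add_of_exact P.subtype P.mkQ P.subtype_injective P.mkQ_surjective
    (LinearMap.exact_subtype_mkQ P)

theorem length_add_eq_of_exact {A B C D : Type*} [AddCommGroup A] [Module R A] [AddCommGroup B]
    [Module R B] [AddCommGroup C] [Module R C] [AddCommGroup D] [Module R D]
    (f : A →ₗ[R] B) (g : B →ₗ[R] C) (h : C →ₗ[R] D) (hf : Function.Injective f)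
    (hfg : Function.Exact f g) (hgh : Function.Exact g h) (hh : Function.Surjective h) :
    Module.length R A + Module.length R C = Module.length R B + Module.length R D := by
  have hB : Module.length R B = Module.length R A + Module.length R (LinearMap.range g) := by
    refine Module.length_eq_add_of_exact f g.rangeRestrict hf g.surjective_rangeRestrict ?_
    intro x
    rw [← hfg x, Subtype.ext_iff]
    rfl
  have hC : Module.length R C = Module.length R (LinearMap.range g) + Module.length R D := by
    refine Module.length_eq_add_of_exact (LinearMap.range g).subtype h
      (Submodule.subtype_injective _) hh ?_
    intro x
    rw [hgh x]
    simp
  rw [hB, hC, add_assoc]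

end Length

/-! ### The Hilbert function -/

section Hilbert

variable (R : Type u) [CommRing R] [IsLocalRing R]

/-- `hilbertFunction` is a dimension over `R / 𝔪`; it equals the length over `R`, so length is
additive along `𝔪 ^ (s + 1) ⊆ 𝔪 ^ s`. -/
theorem length_maximalIdeal_pow [IsNoetherianRing R] (s : ℕ) :
    Module.length R ↥(maximalIdeal R ^ s) =
      Module.length R ↥(maximalIdeal R ^ (s + 1)) + hilbertFunction R s := by
  rw [length_eq_length_submodule_add_length_quotient
    (maximalIdeal R • ⊤ : Submodule R ↥(maximalIdeal R ^ s))]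
  congr 1
  · have e : (maximalIdeal R • ⊤ : Submodule R ↥(maximalIdeal R ^ s)).map
        (Submodule.subtype (maximalIdeal R ^ s)) = maximalIdeal R ^ (s + 1) := by
      rw [Submodule.map_smul'', Submodule.map_top, Submodule.range_subtype, pow_succ',
        smul_eq_mul]
    rw [← e]
    exact (Submodule.equivMapOfInjective _ (Submodule.subtype_injective _) _).length_eq
  · rw [Module.length_eq_of_surjective (R := R ⧸ maximalIdeal R) (S := R)
      Ideal.Quotient.mk_surjective]
    let _ : Field (R ⧸ maximalIdeal R) := Ideal.Quotient.field _
    have : Module.Finite (R ⧸ maximalIdeal R)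
      (↥(maximalIdeal R ^ s) ⧸ (maximalIdeal R • ⊤ : Submodule R ↥(maximalIdeal R ^ s))) :=
      Module.Finite.of_restrictScalars_finite R _ _
    exact Module.length_eq_finrank _ _

theorem hilbertFunction_zero [IsArtinianRing R] : hilbertFunction R 0 = 1 := by
  have h := length_maximalIdeal_pow R 0
  have h' := length_eq_length_submodule_add_length_quotient (maximalIdeal R)
  have : IsSimpleModule R (R ⧸ maximalIdeal R) :=
    isSimpleModule_iff_isCoatom.2 (maximalIdeal.isMaximal R).out
  rw [Module.length_eq_one R (R ⧸ maximalIdeal R)] at h'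
  rw [pow_zero, zero_add, pow_one, Ideal.one_eq_top, Module.length_top, h'] at h
  exact_mod_cast (ENat.add_right_injective_of_ne_top Module.length_ne_top h).symm

theorem hilbertFunction_eq_zero_of_pow_eq_bot {s : ℕ} (hs : maximalIdeal R ^ s = ⊥) :
    hilbertFunction R s = 0 := by
  have : Subsingleton ↥(maximalIdeal R ^ s) := by rw [hs]; infer_instance
  exact Module.finrank_zero_of_subsingleton

end Hilbert

theorem hilbertSeries_eq {R : Type u} [CommRing R] [IsLocalRing R] [IsNoetherianRing R]
    (hR : maximalIdeal R ^ 4 = ⊥) :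
    hilbertSeries R = 1 + PowerSeries.C (hilbertFunction R 1 : ℤ) * PowerSeries.X
      + PowerSeries.C (hilbertFunction R 2 : ℤ) * PowerSeries.X ^ 2
      + PowerSeries.C (hilbertFunction R 3 : ℤ) * PowerSeries.X ^ 3 := by
  have : IsArtinianRing R := (isArtinianRing_iff_isNilpotent_maximalIdeal R).2 ⟨4, hR⟩
  ext i
  simp only [hilbertSeries, map_add, PowerSeries.coeff_mk, PowerSeries.coeff_C_mul,
    PowerSeries.coeff_X_pow, PowerSeries.coeff_X, PowerSeries.coeff_one]
  match i with
  | 0 => simp [hilbertFunction_zero]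
  | 1 => simp
  | 2 => simp
  | 3 => simp
  | i + 4 =>
    have h : maximalIdeal R ^ (i + 4) = ⊥ := by rw [pow_add, hR, Ideal.mul_bot]
    simp [hilbertFunction_eq_zero_of_pow_eq_bot R h]

/-! ### Terms and differentials of the strands -/

section Strands

variable {R : Type u} [CommRing R] [IsLocalRing R]

/-- Comparing the lengths of `𝔪 ^ s N` and `𝔪 ^ (s + 1) N` for `N = C.X i` free of finite rank:
these are direct sums of copies of the powers of `𝔪`.  The common summand can be cancelled since
`R` is Artinian. -/
theorem length_grStrand_X [IsArtinianRing R] (C : ChainComplex (ModuleCat.{v} R) ℕ)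
    (hC : IsMinimalComplex C) (i s j : ℕ) (hj : i + s = j) [Module.Free R (C.X i)]
    [Module.Finite R (C.X i)] :
    Module.length R ((grStrand C hC j).X i) =
      (hilbertFunction R s * Module.finrank R (C.X i) : ℕ) := by
  have e0 : ((j : ℤ) - i).toNat = s := by omega
  have e1 : ((j : ℤ) + 1 - i).toNat = s + 1 := by omega
  have hle : powSMul R ((j : ℤ) + 1 - i) (C.X i) ≤ powSMul R ((j : ℤ) - i) (C.X i) := by
    rw [powSMul, powSMul, e0, e1]
    exact Submodule.smul_mono_left (Ideal.pow_le_pow_right (by omega))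
  have h := length_eq_length_submodule_add_length_quotient
    ((powSMul R ((j : ℤ) + 1 - i) (C.X i)).submoduleOf (powSMul R ((j : ℤ) - i) (C.X i)))
  rw [(Submodule.submoduleOfEquivOfLe hle).length_eq] at h
  have h0 : Module.length R (powSMul R ((j : ℤ) - i) (C.X i)) =
      Module.finrank R (C.X i) * Module.length R ↥(maximalIdeal R ^ s) := by
    rw [powSMul, e0, length_ideal_smul_top]
  have h1 : Module.length R (powSMul R ((j : ℤ) + 1 - i) (C.X i)) =
      Module.finrank R (C.X i) * Module.length R ↥(maximalIdeal R ^ (s + 1)) := by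
    rw [powSMul, e1, length_ideal_smul_top]
  have hfin : Module.finrank R (C.X i) * Module.length R ↥(maximalIdeal R ^ (s + 1)) ≠ ⊤ := by
    rw [← length_ideal_smul_top]
    exact Module.length_ne_top
  rw [h0, h1, length_maximalIdeal_pow, mul_add] at h
  rw [mul_comm (hilbertFunction R s), Nat.cast_mul]
  exact (ENat.add_right_injective_of_ne_top hfin h).symm

theorem subsingleton_grStrand_X_of_lt (C : ChainComplex (ModuleCat.{v} R) ℕ)
    (hC : IsMinimalComplex C) {i j : ℕ} (hij : j < i) :
    Subsingleton ((grStrand C hC j).X i) := by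
  refine Submodule.Quotient.subsingleton_iff.2 (Submodule.submoduleOf_eq_top.2 ?_)
  have e : ((j : ℤ) + 1 - i).toNat = 0 := by omega
  simp [powSMul, e]

theorem subsingleton_grStrand_X_of_pow_eq_bot (C : ChainComplex (ModuleCat.{v} R) ℕ)
    (hC : IsMinimalComplex C) {i s j : ℕ} (hs : maximalIdeal R ^ s = ⊥) (hj : i + s = j) :
    Subsingleton ((grStrand C hC j).X i) := by
  refine Submodule.Quotient.subsingleton_iff.2 (Submodule.submoduleOf_eq_top.2 ?_)
  have e : ((j : ℤ) - i).toNat = s := by omega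
  simp [powSMul, e, hs]

theorem exact_d_of_exactAt {A : Type u} [CommRing A] {C : ChainComplex (ModuleCat.{v} A) ℕ} {i : ℕ}
    (h : C.ExactAt (i + 1)) :
    Function.Exact (C.d (i + 2) (i + 1)).hom (C.d (i + 1) i).hom := by
  rw [C.exactAt_iff' (i + 2) (i + 1) i (by simp) (by simp)] at h
  exact (ShortComplex.ShortExact.moduleCat_exact_iff_function_exact _).1 h

end Strands

/-! ### The recurrence for the Betti numbers -/

namespace MinimalFreeResolution

variable {R : Type u} [CommRing R] [IsLocalRing R] {M : Type v} [AddCommGroup M] [Module R M]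

theorem IsEventuallyLinear.exists_grHomologyVanishes {F : MinimalFreeResolution R M}
    (hF : F.IsEventuallyLinear) : ∃ n, ∀ i ≥ n, F.GrHomologyVanishes i := by
  by_contra! h
  refine hF.ne (iInf_eq_top.2 fun n => iInf_eq_top.2 fun hn => ?_)
  obtain ⟨i, hi, hi'⟩ := h n
  exact absurd (hn i hi) hi'

/-- The strand `gr(F)^(i + 3)` is exact in the degrees `i, …, i + 3`, the only ones in which it is
not zero, so the alternating sum of the lengths of its terms vanishes. -/
theorem eventually_betti_rec [IsNoetherianRing R] (hR : maximalIdeal R ^ 4 = ⊥)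
    (F : MinimalFreeResolution R M) (hF : F.IsEventuallyLinear) :
    ∀ᶠ i : ℕ in atTop, F.betti (i + 3) + hilbertFunction R 2 * F.betti (i + 1) =
      hilbertFunction R 1 * F.betti (i + 2) + hilbertFunction R 3 * F.betti i := by
  have : IsArtinianRing R := (isArtinianRing_iff_isNilpotent_maximalIdeal R).2 ⟨4, hR⟩
  obtain ⟨n, hn⟩ := hF.exists_grHomologyVanishes
  -- The bound `n + 1` ensures that degree `i - 1` exists; the term there is zero since `𝔪 ^ 4 = 0`.
  filter_upwards [eventually_ge_atTop (n + 1)] with i hi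
  obtain ⟨k, rfl⟩ : ∃ k, i = k + 1 := ⟨i - 1, by omega⟩
  let S := grStrand F.toRes.complex F.minimal ((k + 4 : ℕ) : ℤ)
  have ex : ∀ m ≥ k, Function.Exact (S.d (m + 2) (m + 1)).hom (S.d (m + 1) m).hom :=
    fun m hm => exact_d_of_exactAt (hn (m + 1) (by omega) _)
  have hlen : ∀ i s, i + s = k + 4 →
      Module.length R (S.X i) = (hilbertFunction R s * F.betti i : ℕ) := fun i s his =>
    have := F.free i
    have := F.finite i
    length_grStrand_X F.toRes.complex F.minimal i s (k + 4) his
  have htop : Subsingleton (S.X (k + 5)) :=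
    subsingleton_grStrand_X_of_lt _ F.minimal (by omega)
  have hbot : Subsingleton (S.X k) :=
    subsingleton_grStrand_X_of_pow_eq_bot _ F.minimal hR rfl
  have hinj : Function.Injective (S.d (k + 4) (k + 3)).hom := by
    refine (injective_iff_map_eq_zero _).2 fun x hx => ?_
    obtain ⟨y, rfl⟩ := (ex (k + 3) (by omega) x).1 hx
    rw [Subsingleton.elim y 0, map_zero]
  have hsurj : Function.Surjective (S.d (k + 2) (k + 1)).hom := fun x =>
    (ex k le_rfl x).1 (Subsingleton.elim _ _)
  have key := length_add_eq_of_exact _ _ _ hinj (ex (k + 2) (by omega)) (ex (k + 1) (by omega))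
    hsurj
  rw [hlen (k + 4) 0 rfl, hlen (k + 3) 1 rfl, hlen (k + 2) 2 rfl, hlen (k + 1) 3 rfl,
    hilbertFunction_zero, one_mul] at key
  exact_mod_cast key

end MinimalFreeResolution

/-! ### Growth of solutions of the recurrence -/

section Growth

theorem tendsto_shift_div {b w : ℕ → ℝ} {β r : ℝ} (hw : ∀ᶠ i in atTop, w i ≠ 0)
    (hr : Tendsto (fun i => w (i + 1) / w i) atTop (𝓝 r))
    (hb : Tendsto (fun i => b i / w i) atTop (𝓝 β)) (k : ℕ) :
    Tendsto (fun i => b (i + k) / w i) atTop (𝓝 (β * r ^ k)) := by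
  induction k with
  | zero => simpa using hb
  | succ k ih =>
    have h := ((tendsto_add_atTop_iff_nat 1).2 ih).mul hr
    rw [mul_assoc, ← pow_succ] at h
    refine h.congr' ?_
    filter_upwards [(tendsto_add_atTop_nat 1).eventually hw] with i hi
    rw [div_mul_div_cancel₀ hi, add_assoc, add_comm 1 k]

/-- If a solution of a linear recurrence of order three is asymptotic to a nonzero multiple of `w`,
then the limit of the ratios `w (i + 1) / w i` is a root of the characteristic polynomial. -/
theorem characteristic_eq_of_ratio_tendsto {b : ℕ → ℕ} {h₁ h₂ h₃ : ℕ}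
    (hrec : ∀ᶠ i in atTop, b (i + 3) + h₂ * b (i + 1) = h₁ * b (i + 2) + h₃ * b i)
    {w : ℕ → ℝ} {β r : ℝ} (hβ : β ≠ 0) (hw : ∀ᶠ i in atTop, w i ≠ 0)
    (hr : Tendsto (fun i => w (i + 1) / w i) atTop (𝓝 r))
    (hb : Tendsto (fun i => (b i : ℝ) / w i) atTop (𝓝 β)) :
    (h₃ : ℝ) = r * h₂ - r ^ 2 * h₁ + r ^ 3 := by
  have t := fun k => tendsto_shift_div (b := fun i => (b i : ℝ)) hw hr hb k
  have lhs := (t 3).add ((t 1).const_mul (h₂ : ℝ))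
  have rhs := ((t 2).const_mul (h₁ : ℝ)).add ((t 0).const_mul (h₃ : ℝ))
  have e := tendsto_nhds_unique (lhs.congr' ?_) rhs
  · refine mul_left_cancel₀ hβ ?_
    linear_combination -e
  · filter_upwards [hrec] with i hi
    have hi' : (b (i + 3) : ℝ) + h₂ * b (i + 1) = h₁ * b (i + 2) + h₃ * b i := by
      exact_mod_cast hi
    rw [add_zero, mul_div_assoc', mul_div_assoc', mul_div_assoc', ← add_div, ← add_div, hi']

theorem tendsto_div_of_abs_sub_le {b w l : ℕ → ℝ} {β : ℝ} (hw : ∀ᶠ i in atTop, 0 < w i)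
    (hl : Tendsto (fun i => l i / w i) atTop (𝓝 0))
    (hb : ∀ᶠ i in atTop, β * w i - l i ≤ b i ∧ b i ≤ β * w i + l i) :
    Tendsto (fun i => b i / w i) atTop (𝓝 β) := by
  have lo : Tendsto (fun i => β - l i / w i) atTop (𝓝 β) := by
    simpa using tendsto_const_nhds.sub hl
  have up : Tendsto (fun i => β + l i / w i) atTop (𝓝 β) := by
    simpa using tendsto_const_nhds.add hl
  refine tendsto_of_tendsto_of_tendsto_of_le_of_le' lo up ?_ ?_
  · filter_upwards [hw, hb] with i hi hbi
    rw [le_div_iff₀ hi, sub_mul, div_mul_cancel₀ _ hi.ne']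
    exact hbi.1
  · filter_upwards [hw, hb] with i hi hbi
    rw [div_le_iff₀ hi, add_mul, div_mul_cancel₀ _ hi.ne']
    exact hbi.2

theorem characteristic_eq_of_polynomialGrowth {b : ℕ → ℕ} {h₁ h₂ h₃ : ℕ}
    (hrec : ∀ᶠ i in atTop, b (i + 3) + h₂ * b (i + 1) = h₁ * b (i + 2) + h₃ * b i)
    (hb : HasPolynomialGrowth b) : (h₃ : ℤ) = h₂ - h₁ + 1 := by
  obtain ⟨n, α, l, hα, hl, hbl⟩ := hb
  have hw : ∀ᶠ i : ℕ in atTop, 0 < (i : ℝ) ^ n := by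
    filter_upwards [eventually_gt_atTop 0] with i hi
    positivity
  have hr : Tendsto (fun i : ℕ => ((i + 1 : ℕ) : ℝ) ^ n / (i : ℝ) ^ n) atTop (𝓝 1) := by
    have h : Tendsto (fun i : ℕ => (1 + 1 / (i : ℝ)) ^ n) atTop (𝓝 1) := by
      simpa using (tendsto_one_div_atTop_nhds_zero_nat.const_add (1 : ℝ)).pow n
    refine h.congr' ?_
    filter_upwards [eventually_gt_atTop 0] with i hi
    have : (i : ℝ) ≠ 0 := by positivity
    rw [← div_pow, Nat.cast_add_one, add_div, div_self this]
  have h := characteristic_eq_of_ratio_tendsto hrec hα.ne' (hw.mono fun _ h => h.ne') hr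
    (tendsto_div_of_abs_sub_le hw hl hbl)
  rw [one_mul, one_pow, one_mul, one_pow] at h
  exact_mod_cast h

theorem characteristic_eq_of_exponentialGrowth {b : ℕ → ℕ} {h₁ h₂ h₃ : ℕ}
    (hrec : ∀ᶠ i in atTop, b (i + 3) + h₂ * b (i + 1) = h₁ * b (i + 2) + h₃ * b i)
    {a : ℝ} (hb : HasExponentialGrowth a b) : (h₃ : ℝ) = a * h₂ - a ^ 2 * h₁ + a ^ 3 := by
  obtain ⟨ha, β, l, hβ, hl, hbl⟩ := hb
  have ha0 : 0 < a := one_pos.trans ha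
  have hw : ∀ i : ℕ, 0 < a ^ i := fun i => pow_pos ha0 i
  have hr : Tendsto (fun i : ℕ => a ^ (i + 1) / a ^ i) atTop (𝓝 a) :=
    tendsto_const_nhds.congr fun i => by rw [pow_succ', mul_div_cancel_right₀ _ (hw i).ne']
  exact characteristic_eq_of_ratio_tendsto hrec hβ.ne' (.of_forall fun i => (hw i).ne') hr
    (tendsto_div_of_abs_sub_le (.of_forall hw) hl hbl)

end Growth

end LinRes

theorem mainTheorem6 {R : Type u} [CommRing R] [IsLocalRing R] [IsNoetherianRing R]
    (hR : maximalIdeal R ^ 4 = ⊥)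
    {M : Type v} [AddCommGroup M] [Module R M] [Module.Finite R M]
    (F : LinRes.MinimalFreeResolution R M) (hF : F.IsEventuallyLinear)
    (e f : ℤ) (he : e = PowerSeries.coeff 1 (LinRes.hilbertSeries R))
    (hf : f = PowerSeries.coeff 2 (LinRes.hilbertSeries R)) :
    (LinRes.HasPolynomialGrowth F.betti →
      LinRes.hilbertSeries R =
        1 + PowerSeries.C e * PowerSeries.X + PowerSeries.C f * PowerSeries.X ^ 2
          + PowerSeries.C (f - e + 1) * PowerSeries.X ^ 3) ∧
    (∀ a : ℝ, LinRes.HasExponentialGrowth a F.betti →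
      PowerSeries.map (Int.castRingHom ℝ) (LinRes.hilbertSeries R) =
        1 + PowerSeries.C (e : ℝ) * PowerSeries.X + PowerSeries.C (f : ℝ) * PowerSeries.X ^ 2
          + PowerSeries.C (a * f - a ^ 2 * e + a ^ 3) * PowerSeries.X ^ 3) := by
  replace he : e = LinRes.hilbertFunction R 1 := by rw [he, LinRes.hilbertSeries,
    PowerSeries.coeff_mk]
  replace hf : f = LinRes.hilbertFunction R 2 := by rw [hf, LinRes.hilbertSeries,
    PowerSeries.coeff_mk]
  have hrec := F.eventually_betti_rec hR hF
  subst he hf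
  constructor
  · intro hb
    rw [← LinRes.characteristic_eq_of_polynomialGrowth hrec hb]
    exact LinRes.hilbertSeries_eq hR
  · intro a hb
    rw [Int.cast_natCast, Int.cast_natCast,
      ← LinRes.characteristic_eq_of_exponentialGrowth hrec hb, LinRes.hilbertSeries_eq hR]
    simp
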